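/- Let $n\in\mathbb N_0$, $\ell\in\mathbb R^n$, let $Q\in\mathbb R^{n\times n}$ be symmetric and positive semidefinite, and let $\nu$ be a Lévy measure, i.e. a Borel measure on $\mathbb R^n\setminus\{0\}$ with $\int_{y\neq 0}\min\{1,|y|^2\}\,\nu(dy)<\infty$. Let $C_\infty(X)$ denote the space of continuous functions $X\to\mathbb R$ vanishing at infinity on the locally compact space $X$, with the sup-norm. Let $(A,\mathcal D(A))$ be the Lévy operator on $C_\infty(\mathbb R^n)$ with triplet $(\ell,Q,\nu)$, i.e. the closure in $C_\infty(\mathbb R^n)$ of the operator defined on $C_c^\infty(\mathbb R^n)$ by $$Au(x)=\ell\cdot\nabla u(x)+\tfrac12\operatorname{div}(Q\nabla u)(x)+\int_{y\neq0}\bigl(u(x+y)-u(x)-y\cdot\nabla u(x)\,\mathbf 1_{(0,1)}(|y|)\bigr)\,\nu(dy).$$ We say that $A$ has the unique continuation property if for every non-empty open set $G\subset\mathbb R^n$ and every $u\in\mathcal D(A)$, $Au|_G=0$ and $u|_G=0$ imply $u=0$ on $\mathbb R^n$. Then $A$ has the unique continuation property if and only if for every $\epsilon>0$ the linear span of the set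 $$\Sigma(\nu,\epsilon)=\bigl\{\nu(\cdot+x)|_{\mathbb R^n\setminus\overline{B_\epsilon(0)}} : x\in B_\epsilon(0)\bigr\}$$ is dense in the space of bounded signed Radon measures on $\mathbb R^n\setminus\overline{B_\epsilon(0)}$ with respect to the vague (weak-$*$) topology, i.e. the coarsest topology for which $\mu\mapsto\int\phi\,d\mu$ is continuous for every $\phi\in C_\infty(\mathbb R^n\setminus\overline{B_\epsilon(0)})$. In particular, whether $A$ has the unique continuation property depends only on $\nu$, not on $\ell$ and $Q$. -/

import Mathlib

open MeasureTheory Filter Topology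
open scoped ZeroAtInfty ContDiff

noncomputable section

/-- The Euclidean space `ℝⁿ`. -/
abbrev Rn (n : ℕ) : Type := EuclideanSpace ℝ (Fin n)

/-- A Lévy measure on `ℝⁿ ∖ {0}`, regarded as a Borel measure on `ℝⁿ` that does not charge the
origin: `∫ min {1, |y|²} ν(dy) < ∞`. -/
class IsLevyMeasure {n : ℕ} (ν : Measure (Rn n)) : Prop where
  singleton_zero : ν {0} = 0
  lintegral_lt_top : ∫⁻ y, ENNReal.ofReal (min 1 (‖y‖ ^ 2)) ∂ν < ⊤

/-- `div (Q ∇u) (x) = ∑ i, ∂ᵢ (∑ j, Q i j ∂ⱼ u) (x)`. -/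
def divGrad {n : ℕ} (Q : Matrix (Fin n) (Fin n) ℝ) (u : Rn n → ℝ) (x : Rn n) : ℝ :=
  ∑ i, fderiv ℝ (fun z => ∑ j, Q i j * fderiv ℝ u z (EuclideanSpace.single j 1)) x
    (EuclideanSpace.single i 1)

/-- The integro-differential expression of the Lévy operator with triplet `(ℓ, Q, ν)`:
`ℓ · ∇u(x) + ½ div (Q ∇u)(x) + ∫_{y ≠ 0} (u(x + y) - u(x) - y · ∇u(x) 1_{(0,1)}(|y|)) ν(dy)`.
It is only used for test functions `u ∈ C_c^∞(ℝⁿ)`, for which the integral converges absolutely. -/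
def levyExpr {n : ℕ} (l : Rn n) (Q : Matrix (Fin n) (Fin n) ℝ) (ν : Measure (Rn n))
    (u : Rn n → ℝ) (x : Rn n) : ℝ :=
  fderiv ℝ u x l + 1 / 2 * divGrad Q u x +
    ∫ y in {y : Rn n | y ≠ 0},
      (u (x + y) - u x - {y : Rn n | ‖y‖ ∈ Set.Ioo 0 1}.indicator (fun y => fderiv ℝ u x y) y) ∂ν

/-- The graph of the Lévy operator `(A, 𝒟(A))` on `C_∞(ℝⁿ)`, i.e. of the closure, with respect to
the sup-norm, of the operator given by `levyExpr` on `C_c^∞(ℝⁿ)`: `u ∈ 𝒟(A)` and `A u = f` if and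
only if there are test functions `v k` such that `v k → u` and `A (v k) → f` uniformly. -/
def IsLevyOperatorValue {n : ℕ} (l : Rn n) (Q : Matrix (Fin n) (Fin n) ℝ) (ν : Measure (Rn n))
    (u f : C₀(Rn n, ℝ)) : Prop :=
  ∃ v : ℕ → Rn n → ℝ,
    (∀ k, ContDiff ℝ ∞ (v k) ∧ HasCompactSupport (v k)) ∧
    TendstoUniformly v u atTop ∧
    TendstoUniformly (fun k => levyExpr l Q ν (v k)) f atTop

/-- The unique continuation property of the Lévy operator `(A, 𝒟(A))` on `C_∞(ℝⁿ)`: whenever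
`u ∈ 𝒟(A)` and `A u = 0 = u` on some non-empty open set `G`, then `u = 0` on `ℝⁿ`. -/
def HasUCP {n : ℕ} (l : Rn n) (Q : Matrix (Fin n) (Fin n) ℝ) (ν : Measure (Rn n)) : Prop :=
  ∀ G : Set (Rn n), IsOpen G → G.Nonempty →
    ∀ u f : C₀(Rn n, ℝ), IsLevyOperatorValue l Q ν u f →
      (∀ x ∈ G, f x = 0) → (∀ x ∈ G, u x = 0) → u = 0

/-- The exterior domain `ℝⁿ ∖ closure B_ε(0)`. -/
abbrev extDomain (n : ℕ) (ε : ℝ) : Set (Rn n) := (Metric.closedBall (0 : Rn n) ε)ᶜ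

/-- The measure `ν(· + x)`, restricted to `ℝⁿ ∖ closure B_ε(0)`. -/
def shiftRestrict {n : ℕ} (ν : Measure (Rn n)) (ε : ℝ) (x : Rn n) : Measure (extDomain n ε) :=
  (ν.map (fun y => y - x)).comap Subtype.val

theorem shiftRestrict_apply {n : ℕ} (ν : Measure (Rn n)) (ε : ℝ) (x : Rn n)
    {B : Set (extDomain n ε)} (hB : MeasurableSet B) :
    shiftRestrict ν ε x B = ν ((fun z : extDomain n ε => (z : Rn n) + x) '' B) := by
  have hO : MeasurableSet (extDomain n ε) := Metric.isClosed_closedBall.measurableSet.compl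
  rw [shiftRestrict, comap_subtype_coe_apply hO,
    Measure.map_apply (by fun_prop) (hO.subtype_image hB)]
  congr 1
  ext y
  simp only [Set.mem_preimage, Set.mem_image]
  constructor
  · rintro ⟨z, hz, h⟩
    exact ⟨z, hz, by rw [h]; abel⟩
  · rintro ⟨z, hz, rfl⟩
    exact ⟨z, hz, by abel⟩

/-- For `|x| < ε` the shifted and restricted Lévy measure is finite. -/
instance shiftRestrict_isFiniteMeasure {n : ℕ} (ν : Measure (Rn n)) [IsLevyMeasure ν] (ε : ℝ)
    (x : Metric.ball (0 : Rn n) ε) : IsFiniteMeasure (shiftRestrict ν ε x) := by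
  obtain ⟨x, hx⟩ := x
  rw [mem_ball_zero_iff] at hx
  refine ⟨?_⟩
  rw [shiftRestrict_apply ν ε x MeasurableSet.univ]
  set c : ℝ := min 1 ((ε - ‖x‖) ^ 2) with hc
  have hcpos : 0 < c := lt_min one_pos (pow_pos (sub_pos.2 hx) 2)
  refine lt_of_le_of_lt (measure_mono (t := {y | ENNReal.ofReal c ≤
    ENNReal.ofReal (min 1 (‖y‖ ^ 2))}) ?_) ?_
  · rintro _ ⟨⟨z, hz⟩, -, rfl⟩
    rw [Set.mem_compl_iff, mem_closedBall_zero_iff, not_le] at hz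
    refine ENNReal.ofReal_le_ofReal (min_le_min le_rfl ?_)
    have h1 : ‖z‖ ≤ ‖z + x‖ + ‖x‖ := by
      simpa using norm_sub_le (z + x) x
    exact pow_le_pow_left₀ (sub_nonneg.2 hx.le) (by dsimp only; linarith) 2
  · refine lt_of_le_of_lt (meas_ge_le_lintegral_div (by fun_prop)
      (by simpa using hcpos) ENNReal.ofReal_ne_top) ?_
    exact ENNReal.div_lt_top IsLevyMeasure.lintegral_lt_top.ne (by simpa using hcpos)

/-- The set `Σ(ν, ε)` of the shifted Lévy measures `ν(· + x)`, `x ∈ B_ε(0)`, restricted to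
`ℝⁿ ∖ closure B_ε(0)`, as a subset of the finite signed measures. -/
def shiftedLevyMeasures {n : ℕ} (ν : Measure (Rn n)) [IsLevyMeasure ν] (ε : ℝ) :
    Set (SignedMeasure (extDomain n ε)) :=
  Set.range fun x : Metric.ball (0 : Rn n) ε => (shiftRestrict ν ε x).toSignedMeasure

/-- The vague (weak-∗) topology on the finite signed measures on `X`: the coarsest topology for
which `μ ↦ ∫ φ dμ` is continuous for every `φ ∈ C_∞(X)`. For an open subset `X` of `ℝⁿ` the type
`SignedMeasure X` consists of all bounded signed Radon measures on `X`. -/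
abbrev vagueTopology (X : Type*) [TopologicalSpace X] [MeasurableSpace X] :
    TopologicalSpace (SignedMeasure X) :=
  TopologicalSpace.induced (fun μ (φ : C₀(X, ℝ)) => ∫ᵛ x, φ x ∂<•μ) Pi.topologicalSpace

end

/-! A span of finite signed measures is vaguely dense exactly when its annihilator in `C₀` is
trivial (`dense_span_vagueTopology_iff`). An annihilator `φ` of `Σ(ν, ε)`, extended by zero, is a
`u` in `C₀(ℝⁿ)` that vanishes on the closed ball and satisfies `∫ u(x + y) ν(dy) = 0` for `|x| < ε`.
Where `u` vanishes on an open set, the drift, the diffusion and the compensator drop out, so this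
integral is formally `Au(x)`; hence `ℓ` and `Q` play no role. Two gaps separate this formal argument
from a proof.

For density ⇒ unique continuation, `u` lies only in the domain of the closure, and its approximating
test functions need not vanish where `u` does. The formula for `Au` is then obtained from the
positive maximum principle (`eq_setIntegral_of_isLevyOperatorValue`), which is where `Q ≥ 0` enters.

For unique continuation ⇒ density, an annihilating `u` need not belong to the domain. Its
mollifications do (`exists_isLevyOperatorValue_mollify`), they inherit both conditions on a smaller
ball (`levyExpr_mollify_eq_zero`), and they converge to `u`. -/

noncomputable section

/-! ### Vague density and annihilators -/

section VagueDuality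

variable {X : Type*} [MeasurableSpace X]

theorem isFiniteMeasure_variation (μ : SignedMeasure X) : IsFiniteMeasure μ.variation := by
  have h : μ = μ.toJordanDecomposition.posPart.toSignedMeasure
      + -μ.toJordanDecomposition.negPart.toSignedMeasure := by
    conv_lhs => rw [← μ.toSignedMeasure_toJordanDecomposition]
    rw [JordanDecomposition.toSignedMeasure, sub_eq_add_neg]
  rw [h]
  refine isFiniteMeasure_of_le (μ.toJordanDecomposition.posPart
    + μ.toJordanDecomposition.negPart) (VectorMeasure.variation_add_le.trans ?_)
  rw [VectorMeasure.variation_neg, Measure.variation_toSignedMeasure,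
    Measure.variation_toSignedMeasure]

variable [TopologicalSpace X] [OpensMeasurableSpace X]

theorem ZeroAtInftyContinuousMap.integrable_signedMeasure (φ : C₀(X, ℝ)) (μ : SignedMeasure X) :
    μ.Integrable φ := by
  have := isFiniteMeasure_variation μ
  obtain ⟨C, hC⟩ := (ZeroAtInftyContinuousMap.isBounded_range φ).exists_norm_le
  exact MeasureTheory.Integrable.of_bound φ.continuous.aestronglyMeasurable C
    (.of_forall fun x => hC _ ⟨x, rfl⟩)

/-- The pairing of a finite signed measure with a function vanishing at infinity, as a linear map
in the measure. -/
def vaguePairing (φ : C₀(X, ℝ)) : SignedMeasure X →ₗ[ℝ] ℝ where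
  toFun μ := ∫ᵛ x, φ x ∂<•μ
  map_add' μ μ' := VectorMeasure.integral_add_vectorMeasure
    (φ.integrable_signedMeasure μ) (φ.integrable_signedMeasure μ')
  map_smul' c μ := by simp [VectorMeasure.integral_smul_vectorMeasure]

theorem vaguePairing_apply (φ : C₀(X, ℝ)) (μ : SignedMeasure X) :
    vaguePairing φ μ = ∫ᵛ x, φ x ∂<•μ := rfl

theorem vaguePairing_sum_smul (I : Finset C₀(X, ℝ)) (c : I → ℝ) (μ : SignedMeasure X) :
    vaguePairing (∑ i, c i • (i : C₀(X, ℝ))) μ = ∑ i, c i * vaguePairing (i : C₀(X, ℝ)) μ := by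
  have h : ((∑ i, c i • (i : C₀(X, ℝ)) : C₀(X, ℝ)) : X → ℝ)
      = fun x => ∑ i, (c i • (i : C₀(X, ℝ))) x := by
    ext x
    let ev : C₀(X, ℝ) →+ ℝ := ⟨⟨fun f => f x, rfl⟩, fun _ _ => rfl⟩
    exact map_sum ev _ _
  rw [vaguePairing_apply, h, VectorMeasure.integral_finsetSum _
    fun i _ => (c i • (i : C₀(X, ℝ))).integrable_signedMeasure μ]
  refine Finset.sum_congr rfl fun i _ => ?_
  rw [vaguePairing_apply]
  exact VectorMeasure.integral_fun_smul (μ := μ) (B := _) (c i) (i : C₀(X, ℝ))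

/-- A linear span of finite signed measures is vaguely dense if and only if no non-zero function
vanishing at infinity annihilates it. -/
theorem dense_span_vagueTopology_iff (S : Set (SignedMeasure X)) :
    @Dense (SignedMeasure X) (vagueTopology X) (Submodule.span ℝ S : Set (SignedMeasure X)) ↔
      ∀ φ : C₀(X, ℝ), (∀ μ ∈ S, ∫ᵛ x, φ x ∂<•μ = 0) → φ = 0 := by
  classical
  constructor
  · let _ := vagueTopology X
    intro hd φ hφ
    have hspan : (Submodule.span ℝ S : Set (SignedMeasure X)) ⊆ {μ | vaguePairing φ μ = 0} :=
      (Submodule.span_le (p := LinearMap.ker (vaguePairing φ))).2 hφ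
    have hcont : Continuous (vaguePairing φ) :=
      (continuous_apply φ).comp (continuous_induced_dom (f := fun (μ : SignedMeasure X)
        (φ : C₀(X, ℝ)) => ∫ᵛ x, φ x ∂<•μ))
    have hclosed : IsClosed {μ : SignedMeasure X | vaguePairing φ μ = 0} :=
      (isClosed_singleton (x := (0 : ℝ))).preimage hcont
    have hall : ∀ μ : SignedMeasure X, vaguePairing φ μ = 0 := fun μ =>
      closure_minimal hspan hclosed (hd μ)
    ext x
    have := hall (VectorMeasure.dirac x 1)
    rw [vaguePairing_apply, VectorMeasure.integral_dirac' (f := φ)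
      φ.continuous.stronglyMeasurable] at this
    simpa using this
  · intro h μ₀
    rw [closure_induced, mem_closure_iff]
    intro o ho hμ₀
    obtain ⟨I, u, hu, huo⟩ := isOpen_pi_iff.1 ho _ hμ₀
    let T : SignedMeasure X →ₗ[ℝ] (I → ℝ) := LinearMap.pi fun i => vaguePairing (i : C₀(X, ℝ))
    -- A basic vague neighbourhood tests only finitely many functions. A functional on `I → ℝ`
    -- separating `T μ₀` from the image of the span is pairing with one linear combination of these
    -- functions, which then annihilates `S`.
    have hT : T μ₀ ∈ (Submodule.span ℝ S).map T := by
      by_contra hn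
      obtain ⟨f, hf, hker⟩ := Submodule.exists_le_ker_of_notMem hn
      have hfT : ∀ μ, f (T μ) = vaguePairing (∑ i, f (Pi.single i 1) • (i : C₀(X, ℝ))) μ := by
        intro μ
        rw [vaguePairing_sum_smul, LinearMap.pi_apply_eq_sum_univ f (T μ)]
        refine Finset.sum_congr rfl fun i _ => ?_
        rw [smul_eq_mul, mul_comm]
        congr 2
        ext j
        simp [Pi.single_apply, eq_comm]
      have h0 := h (∑ i, f (Pi.single i 1) • (i : C₀(X, ℝ))) fun μ hμ => by
        rw [← vaguePairing_apply, ← hfT]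
        exact hker ⟨μ, Submodule.subset_span hμ, rfl⟩
      apply hf
      rw [hfT, h0, vaguePairing_apply]
      exact VectorMeasure.integral_zero
    obtain ⟨σ, hσ, hTσ⟩ := hT
    refine ⟨_, huo ?_, ⟨σ, hσ, rfl⟩⟩
    intro i hi
    have := congrFun hTσ ⟨i, hi⟩
    change vaguePairing i σ ∈ u i
    change vaguePairing i σ = vaguePairing i μ₀ at this
    rw [this]
    exact (hu i hi).2

end VagueDuality

/-! ### Bounds and continuity for the Lévy expression on `C²` functions -/

section LevyBounds

variable {n : ℕ}

/-- A `C²` function that is bounded by `M` together with its first two derivatives. -/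
structure C2Bdd (v : Rn n → ℝ) (M : ℝ) : Prop where
  contDiff : ContDiff ℝ 2 v
  norm_le : ∀ x, ‖v x‖ ≤ M
  norm_fderiv_le : ∀ x, ‖fderiv ℝ v x‖ ≤ M
  norm_fderiv_fderiv_le : ∀ x, ‖fderiv ℝ (fderiv ℝ v) x‖ ≤ M

namespace C2Bdd

variable {v w : Rn n → ℝ} {M N : ℝ}

theorem nonneg (h : C2Bdd v M) : 0 ≤ M := (norm_nonneg _).trans (h.norm_le 0)

theorem differentiable (h : C2Bdd v M) : Differentiable ℝ v :=
  h.contDiff.differentiable (by norm_num)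

theorem contDiff_fderiv (h : C2Bdd v M) : ContDiff ℝ 1 (fderiv ℝ v) :=
  h.contDiff.fderiv_right (by norm_num)

theorem differentiable_fderiv (h : C2Bdd v M) : Differentiable ℝ (fderiv ℝ v) :=
  h.contDiff_fderiv.differentiable (by norm_num)

theorem fderiv_add_mul (hv : C2Bdd v M) (hw : C2Bdd w N) (c : ℝ) :
    fderiv ℝ (fun x => v x + c * w x) = fun x => fderiv ℝ v x + c • fderiv ℝ w x := by
  ext1 x
  rw [fderiv_fun_add hv.differentiable.differentiableAt
    (hw.differentiable.differentiableAt.const_mul c), fderiv_const_mul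
    hw.differentiable.differentiableAt]

theorem fderiv_fderiv_add_mul (hv : C2Bdd v M) (hw : C2Bdd w N) (c : ℝ) (x : Rn n) :
    fderiv ℝ (fderiv ℝ (fun x => v x + c * w x)) x
      = fderiv ℝ (fderiv ℝ v) x + c • fderiv ℝ (fderiv ℝ w) x := by
  rw [fderiv_add_mul hv hw]
  exact ((hv.differentiable_fderiv x).hasFDerivAt.add
    ((hw.differentiable_fderiv x).hasFDerivAt.const_smul c)).fderiv

/-- The form `v + c * w` serves three purposes: perturbation by a small bump, negation (`w = v`, `c
= -2`) and differences of mollifications (`c = 1`). -/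
theorem add_mul (hv : C2Bdd v M) (hw : C2Bdd w N) (c : ℝ) :
    C2Bdd (fun x => v x + c * w x) (M + |c| * N) where
  contDiff := hv.contDiff.add (contDiff_const.mul hw.contDiff)
  norm_le x := by
    refine (norm_add_le _ _).trans (add_le_add (hv.norm_le x) ?_)
    rw [norm_mul, Real.norm_eq_abs c]
    gcongr
    exact hw.norm_le x
  norm_fderiv_le x := by
    rw [fderiv_add_mul hv hw]
    refine (norm_add_le _ _).trans (add_le_add (hv.norm_fderiv_le x) ?_)
    rw [norm_smul, Real.norm_eq_abs c]
    gcongr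
    exact hw.norm_fderiv_le x
  norm_fderiv_fderiv_le x := by
    rw [fderiv_fderiv_add_mul hv hw]
    refine (ContinuousLinearMap.opNorm_add_le _ _).trans
      (add_le_add (hv.norm_fderiv_fderiv_le x) ((ContinuousLinearMap.opNorm_smul_le _ _).trans ?_))
    rw [Real.norm_eq_abs c]
    exact mul_le_mul_of_nonneg_left (hw.norm_fderiv_fderiv_le x) (abs_nonneg c)

end C2Bdd

theorem exists_c2Bdd_of_hasCompactSupport {v : Rn n → ℝ} (hv : ContDiff ℝ ∞ v)
    (hs : HasCompactSupport v) : ∃ M, C2Bdd v M := by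
  have h2 : ContDiff ℝ 2 v := hv.of_le (by norm_cast)
  have h1 : ContDiff ℝ 1 (fderiv ℝ v) := h2.fderiv_right (by norm_num)
  obtain ⟨M₀, h₀⟩ := h2.continuous.bounded_above_of_compact_support hs
  obtain ⟨M₁, h₁⟩ := h1.continuous.bounded_above_of_compact_support (hs.fderiv ℝ)
  obtain ⟨M₂, h₂⟩ := (h1.continuous_fderiv (by norm_num)).bounded_above_of_compact_support
    ((hs.fderiv ℝ).fderiv ℝ)
  exact ⟨max M₀ (max M₁ M₂), h2, fun x => (h₀ x).trans (by simp), fun x => (h₁ x).trans (by simp),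
    fun x => (h₂ x).trans (by simp)⟩

/-- The integrand in the non-local part of the Lévy operator. -/
def levyJump (v : Rn n → ℝ) (x y : Rn n) : ℝ :=
  v (x + y) - v x - {y : Rn n | ‖y‖ ∈ Set.Ioo 0 1}.indicator (fun y => fderiv ℝ v x y) y

theorem levyExpr_eq (l : Rn n) (Q : Matrix (Fin n) (Fin n) ℝ) (ν : Measure (Rn n))
    (v : Rn n → ℝ) (x : Rn n) : levyExpr l Q ν v x =
      fderiv ℝ v x l + 1 / 2 * divGrad Q v x + ∫ y in {y : Rn n | y ≠ 0}, levyJump v x y ∂ν := rfl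

theorem measurableSet_norm_mem_Ioo : MeasurableSet {y : Rn n | ‖y‖ ∈ Set.Ioo 0 1} :=
  measurable_norm measurableSet_Ioo

theorem divGrad_eq {v : Rn n → ℝ} (hv : Differentiable ℝ (fderiv ℝ v))
    (Q : Matrix (Fin n) (Fin n) ℝ) (x : Rn n) :
    divGrad Q v x = ∑ i, ∑ j, Q i j *
      fderiv ℝ (fderiv ℝ v) x (EuclideanSpace.single i 1) (EuclideanSpace.single j 1) := by
  unfold divGrad
  refine Finset.sum_congr rfl fun i _ => ?_
  have hd : ∀ j, HasFDerivAt (fun z => Q i j * fderiv ℝ v z (EuclideanSpace.single j 1))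
      (Q i j • (fderiv ℝ (fderiv ℝ v) x).flip (EuclideanSpace.single j 1)) x := by
    intro j
    have h := ((hv x).hasFDerivAt.clm_apply
      (hasFDerivAt_const (EuclideanSpace.single j (1 : ℝ)) x)).const_mul (Q i j)
    simpa using h
  rw [(HasFDerivAt.fun_sum fun j _ => hd j).fderiv]
  simp

namespace C2Bdd

variable {v w : Rn n → ℝ} {M N : ℝ}

/-- For `‖y‖ < 1` this is a first-order Taylor estimate, with remainder controlled by the second
derivative; for `‖y‖ ≥ 1` the compensator is absent and the sup bound suffices. The majorant is
`ν`-integrable and independent of `x`. -/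
theorem norm_levyJump_le (h : C2Bdd v M) (x y : Rn n) :
    ‖levyJump v x y‖ ≤ 2 * M * min 1 (‖y‖ ^ 2) := by
  have hM := h.nonneg
  rcases eq_or_ne y 0 with rfl | hy
  · simp [levyJump]
  have hy0 : 0 < ‖y‖ := norm_pos_iff.2 hy
  unfold levyJump
  by_cases hy1 : ‖y‖ < 1
  · rw [Set.indicator_of_mem (by exact ⟨hy0, hy1⟩), min_eq_right (by nlinarith)]
    have hb : ∀ z ∈ Metric.closedBall x ‖y‖, ‖fderiv ℝ v z - fderiv ℝ v x‖ ≤ M * ‖y‖ := by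
      intro z hz
      refine ((convex_univ).norm_image_sub_le_of_norm_fderiv_le (𝕜 := ℝ) (f := fderiv ℝ v)
        (fun z _ => h.differentiable_fderiv z) (fun z _ => h.norm_fderiv_fderiv_le z)
        (Set.mem_univ x) (Set.mem_univ z)).trans ?_
      gcongr
      exact mem_closedBall_iff_norm.1 hz
    have := (convex_closedBall x ‖y‖).norm_image_sub_le_of_norm_fderiv_le' (𝕜 := ℝ) (f := v)
      (fun z _ => h.differentiable z) hb (Metric.mem_closedBall_self (norm_nonneg _))
      (y := x + y) (by simp)
    rw [add_sub_cancel_left] at this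
    refine this.trans ?_
    nlinarith [mul_nonneg hM (sq_nonneg ‖y‖)]
  · rw [Set.indicator_of_notMem (by simp only [Set.mem_ofPred_eq, Set.mem_Ioo]; tauto), sub_zero,
      min_eq_left (by nlinarith)]
    refine (norm_sub_le _ _).trans ?_
    linarith [h.norm_le x, h.norm_le (x + y)]

theorem measurable_levyJump (h : C2Bdd v M) (x : Rn n) : Measurable (levyJump v x) := by
  have := h.contDiff.continuous
  unfold levyJump
  refine Measurable.sub (by fun_prop) ?_
  exact Measurable.indicator (fderiv ℝ v x).measurable measurableSet_norm_mem_Ioo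

end C2Bdd

theorem integrable_min_one_sq (ν : Measure (Rn n)) [h : IsLevyMeasure ν] :
    Integrable (fun y : Rn n => min 1 (‖y‖ ^ 2)) ν := by
  refine ⟨by fun_prop, ?_⟩
  rw [hasFiniteIntegral_iff_ofReal (.of_forall fun y => by positivity)]
  exact h.lintegral_lt_top

theorem measure_norm_ge_lt_top (ν : Measure (Rn n)) [IsLevyMeasure ν] {r : ℝ} (hr : 0 < r) :
    ν {y | r ≤ ‖y‖} < ⊤ := by
  have hc : 0 < min 1 (r ^ 2) := by positivity
  refine lt_of_le_of_lt (measure_mono fun y hy => ?_)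
    ((integrable_min_one_sq ν).measure_norm_ge_lt_top hc)
  have : r ≤ ‖y‖ := hy
  rw [Set.mem_ofPred_eq, Real.norm_of_nonneg (by positivity)]
  gcongr

variable {ν : Measure (Rn n)} [IsLevyMeasure ν]

namespace C2Bdd

variable {v w : Rn n → ℝ} {M N : ℝ}

theorem integrable_levyJump (h : C2Bdd v M) (x : Rn n) : Integrable (levyJump v x) ν :=
  ((integrable_min_one_sq ν).const_mul (2 * M)).mono' (h.measurable_levyJump x).aestronglyMeasurable
    (.of_forall fun y => h.norm_levyJump_le x y)

theorem levyExpr_add_mul (hv : C2Bdd v M) (hw : C2Bdd w N) (c : ℝ) (l : Rn n)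
    (Q : Matrix (Fin n) (Fin n) ℝ) (x : Rn n) :
    levyExpr l Q ν (fun x => v x + c * w x) x = levyExpr l Q ν v x + c * levyExpr l Q ν w x := by
  have hj : levyJump (fun x => v x + c * w x) x = fun y => levyJump v x y + c * levyJump w x y := by
    ext y
    simp only [levyJump, fderiv_add_mul hv hw, Set.indicator]
    split_ifs
    · simp; ring
    · ring
  rw [levyExpr_eq, levyExpr_eq, levyExpr_eq, divGrad_eq (hv.add_mul hw c).differentiable_fderiv,
    divGrad_eq hv.differentiable_fderiv, divGrad_eq hw.differentiable_fderiv,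
    fderiv_fderiv_add_mul hv hw, fderiv_add_mul hv hw, hj,
    integral_add (hv.integrable_levyJump x).integrableOn
      ((hw.integrable_levyJump x).integrableOn.const_mul c), integral_const_mul]
  simp only [add_apply, smul_apply, smul_eq_mul,
    _root_.mul_add, Finset.sum_add_distrib, Finset.mul_sum]
  rw [← sub_eq_zero]
  ring_nf

variable (ν) in
-- The constant depends only on the triplet, so convergence in the `C²` norm gives uniform
-- convergence of the Lévy expressions.
theorem exists_norm_levyExpr_le (l : Rn n) (Q : Matrix (Fin n) (Fin n) ℝ) :
    ∃ C, 0 ≤ C ∧ ∀ (v : Rn n → ℝ) (M : ℝ), C2Bdd v M → ∀ x, ‖levyExpr l Q ν v x‖ ≤ C * M := by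
  refine ⟨‖l‖ + 1 / 2 * ∑ i, ∑ j, |Q i j| + 2 * ∫ y, min 1 (‖y‖ ^ 2) ∂ν, ?_, ?_⟩
  · have : 0 ≤ ∫ y, min 1 (‖y‖ ^ 2) ∂ν := integral_nonneg fun y => by positivity
    positivity
  intro v M h x
  rw [levyExpr_eq]
  have h1 : ‖fderiv ℝ v x l‖ ≤ M * ‖l‖ := (fderiv ℝ v x).le_of_opNorm_le (h.norm_fderiv_le x) l
  have h2 : ‖divGrad Q v x‖ ≤ ∑ i, ∑ j, |Q i j| * M := by
    rw [divGrad_eq h.differentiable_fderiv]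
    refine norm_sum_le_of_le _ fun i _ => norm_sum_le_of_le _ fun j _ => ?_
    rw [norm_mul, Real.norm_eq_abs (Q i j)]
    gcongr
    refine ((fderiv ℝ (fderiv ℝ v) x).le_opNorm₂ _ _).trans ?_
    simpa using h.norm_fderiv_fderiv_le x
  have h3 : ‖∫ y in {y : Rn n | y ≠ 0}, levyJump v x y ∂ν‖
      ≤ 2 * M * ∫ y, min 1 (‖y‖ ^ 2) ∂ν := by
    rw [← integral_const_mul]
    refine (norm_integral_le_of_norm_le ((integrable_min_one_sq ν).const_mul (2 * M)).integrableOn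
      (.of_forall fun y => h.norm_levyJump_le x y)).trans ?_
    refine setIntegral_le_integral ((integrable_min_one_sq ν).const_mul (2 * M))
      (.of_forall fun y => ?_)
    have := h.nonneg
    positivity
  simp only [← Finset.sum_mul] at h2
  refine (norm_add₃_le).trans ?_
  rw [norm_mul, show ‖(1 / 2 : ℝ)‖ = 1 / 2 by norm_num]
  linarith

/-- Dominated convergence for a general filter: neighbourhoods of a point give continuity,
`cocompact` gives decay at infinity. -/
theorem tendsto_integral_levyJump (h : C2Bdd v M) {f : Filter (Rn n)} [f.IsCountablyGenerated]
    {g : Rn n → ℝ} (hg : ∀ y, Tendsto (fun x => levyJump v x y) f (𝓝 (g y))) :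
    Tendsto (fun x => ∫ y in {y : Rn n | y ≠ 0}, levyJump v x y ∂ν) f
      (𝓝 (∫ y in {y : Rn n | y ≠ 0}, g y ∂ν)) :=
  tendsto_integral_filter_of_dominated_convergence (fun y => 2 * M * min 1 (‖y‖ ^ 2))
    (.of_forall fun x => (h.measurable_levyJump x).aestronglyMeasurable)
    (.of_forall fun x => .of_forall fun y => h.norm_levyJump_le x y)
    ((integrable_min_one_sq ν).const_mul (2 * M)).integrableOn (.of_forall hg)

theorem continuous_levyExpr (h : C2Bdd v M) (l : Rn n) (Q : Matrix (Fin n) (Fin n) ℝ) :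
    Continuous (levyExpr l Q ν v) := by
  have h0 := h.contDiff.continuous
  have h1 := h.contDiff_fderiv.continuous
  have h2 := h.contDiff_fderiv.continuous_fderiv (by norm_num)
  have hj : Continuous fun x => ∫ y in {y : Rn n | y ≠ 0}, levyJump v x y ∂ν := by
    refine continuous_iff_continuousAt.2 fun x => h.tendsto_integral_levyJump fun y => ?_
    refine Continuous.tendsto (f := fun x => levyJump v x y) ?_ x
    unfold levyJump
    simp only [Set.indicator]
    split_ifs <;> fun_prop
  have hd : Continuous (divGrad Q v) := by
    rw [funext (divGrad_eq h.differentiable_fderiv Q)]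
    fun_prop
  simp only [funext (levyExpr_eq l Q ν v)]
  fun_prop

end C2Bdd

instance : (cocompact (Rn n)).IsCountablyGenerated := by
  rw [← Metric.cobounded_eq_cocompact, ← comap_norm_atTop]
  infer_instance

theorem _root_.HasCompactSupport.tendsto_cocompact_zero {E : Type*} [NormedAddCommGroup E]
    {v : Rn n → E} (hs : HasCompactSupport v) : Tendsto v (cocompact (Rn n)) (𝓝 0) :=
  tendsto_nhds_of_eventually_eq (by
    filter_upwards [hs.isCompact.compl_mem_cocompact] with x hx
    exact image_eq_zero_of_notMem_tsupport hx)

theorem hasCompactSupport_divGrad {v : Rn n → ℝ} (hd : Differentiable ℝ (fderiv ℝ v))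
    (hs : HasCompactSupport v) (Q : Matrix (Fin n) (Fin n) ℝ) : HasCompactSupport (divGrad Q v) := by
  refine HasCompactSupport.intro hs.isCompact fun x hx => ?_
  have h2 : fderiv ℝ (fderiv ℝ v) x = 0 := image_eq_zero_of_notMem_tsupport fun h =>
    hx (tsupport_fderiv_subset ℝ (tsupport_fderiv_subset ℝ h))
  simp [divGrad_eq hd, h2]

theorem tendsto_integral_levyJump_cocompact {v : Rn n → ℝ} {M : ℝ} (h : C2Bdd v M)
    (hs : HasCompactSupport v) :
    Tendsto (fun x => ∫ y in {y : Rn n | y ≠ 0}, levyJump v x y ∂ν) (cocompact (Rn n)) (𝓝 0) := by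
  have t0 := hs.tendsto_cocompact_zero
  have t1 : ∀ y, Tendsto (fun x => fderiv ℝ v x y) (cocompact (Rn n)) (𝓝 0) := fun y =>
    (hs.fderiv_apply ℝ y).tendsto_cocompact_zero
  rw [← integral_zero (Rn n) ℝ (μ := ν.restrict {y : Rn n | y ≠ 0})]
  refine h.tendsto_integral_levyJump fun y => ?_
  have ta : Tendsto (fun x => v (x + y)) (cocompact (Rn n)) (𝓝 0) :=
    t0.comp (Homeomorph.addRight y).isClosedEmbedding.tendsto_cocompact
  unfold levyJump
  by_cases hy : y ∈ {y : Rn n | ‖y‖ ∈ Set.Ioo 0 1}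
  · simpa only [Set.indicator_of_mem hy, sub_zero] using (ta.sub t0).sub (t1 y)
  · simpa only [Set.indicator_of_notMem hy, sub_zero] using ta.sub t0

theorem tendsto_levyExpr_cocompact {v : Rn n → ℝ} (hv : ContDiff ℝ ∞ v)
    (hs : HasCompactSupport v) (l : Rn n) (Q : Matrix (Fin n) (Fin n) ℝ) :
    Tendsto (levyExpr l Q ν v) (cocompact (Rn n)) (𝓝 0) := by
  obtain ⟨M, h⟩ := exists_c2Bdd_of_hasCompactSupport hv hs
  have := ((hs.fderiv_apply ℝ l).tendsto_cocompact_zero.add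
    ((hasCompactSupport_divGrad h.differentiable_fderiv hs Q).tendsto_cocompact_zero.const_mul
      (1 / 2))).add
    (tendsto_integral_levyJump_cocompact (ν := ν) h hs)
  rw [mul_zero, add_zero, add_zero] at this
  exact this

end LevyBounds

/-! ### The positive maximum principle and locality of the closure -/

section MaximumPrinciple

variable {n : ℕ} {v w : Rn n → ℝ} {M N : ℝ}

/-- If the second derivative along `b` were positive, the maximum would also be a local minimum
along that line; the function would be locally constant there and its second derivative zero. -/
theorem C2Bdd.fderiv_fderiv_nonpos_of_isLocalMax (h : C2Bdd w M) {x : Rn n} (hx : IsLocalMax w x)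
    (b : Rn n) : fderiv ℝ (fderiv ℝ w) x b b ≤ 0 := by
  by_contra! hpos
  have hline : ∀ t : ℝ, HasDerivAt (fun t : ℝ => x + t • b) b t := fun t => by
    simpa using ((hasDerivAt_id t).smul_const b).const_add x
  have hg : deriv (fun t : ℝ => w (x + t • b)) = fun t => fderiv ℝ w (x + t • b) b :=
    funext fun t => ((h.differentiable _).hasFDerivAt.comp_hasDerivAt t (hline t)).deriv
  have hgg : deriv (deriv (fun t : ℝ => w (x + t • b))) 0 = fderiv ℝ (fderiv ℝ w) x b b := by
    rw [hg]
    have := (h.differentiable_fderiv _).hasFDerivAt.comp_hasDerivAt (0 : ℝ) (hline 0)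
    simpa using! (this.clm_apply (hasDerivAt_const (0 : ℝ) b)).deriv
  have hc : Continuous fun t : ℝ => x + t • b := by fun_prop
  have hmax : IsLocalMax (fun t : ℝ => w (x + t • b)) 0 := by
    have : Tendsto (fun t : ℝ => x + t • b) (𝓝 0) (𝓝 x) := hc.tendsto' 0 x (by simp)
    simpa [IsLocalMax, IsMaxFilter] using this.eventually hx
  have hmin : IsLocalMin (fun t : ℝ => w (x + t • b)) 0 :=
    isLocalMin_of_deriv_deriv_pos (by rwa [hgg]) hmax.deriv_eq_zero
      (h.contDiff.continuous.comp hc).continuousAt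
  have hconst : (fun t : ℝ => w (x + t • b)) =ᶠ[𝓝 0] fun _ => w (x + (0 : ℝ) • b) := by
    filter_upwards [hmax, hmin] with t h1 h2 using le_antisymm h1 h2
  have := hconst.deriv.deriv_eq
  rw [hgg] at this
  simp at this
  linarith

/-- Writing `Q` as a sum of rank-one matrices `b bᵀ` turns `divGrad` into a sum of second
directional derivatives. -/
theorem C2Bdd.divGrad_nonpos_of_isLocalMax (h : C2Bdd w M) {x : Rn n} (hx : IsLocalMax w x)
    {Q : Matrix (Fin n) (Fin n) ℝ} (hQ : Q.PosSemidef) : divGrad Q w x ≤ 0 := by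
  obtain ⟨m, b, rfl⟩ := Matrix.posSemidef_iff_eq_sum_vecMulVec.1 hQ
  have key : divGrad (∑ k, Matrix.vecMulVec (b k) (star (b k))) w x =
      ∑ k, fderiv ℝ (fderiv ℝ w) x (∑ i, b k i • EuclideanSpace.single i 1)
        (∑ i, b k i • EuclideanSpace.single i 1) := by
    simp only [divGrad_eq h.differentiable_fderiv, Matrix.sum_apply, Matrix.vecMulVec_apply,
      star_trivial, map_sum, map_smul, sum_apply, smul_apply, smul_eq_mul,
      Finset.sum_mul, Finset.mul_sum]
    rw [Finset.sum_congr rfl fun i _ => Finset.sum_comm, Finset.sum_comm]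
    refine Finset.sum_congr rfl fun k _ => ?_
    rw [Finset.sum_comm]
    exact Finset.sum_congr rfl fun i _ => Finset.sum_congr rfl fun j _ => by ring
  rw [key]
  exact Finset.sum_nonpos fun k _ => h.fderiv_fderiv_nonpos_of_isLocalMax hx _

variable {ν : Measure (Rn n)} [IsLevyMeasure ν]

theorem integrableOn_norm_ge {g : Rn n → ℝ} (hg : Continuous g) {C : ℝ} (hC : ∀ x, ‖g x‖ ≤ C)
    {r : ℝ} (hr : 0 < r) : IntegrableOn g {y | r ≤ ‖y‖} ν :=
  Measure.integrableOn_of_bounded (measure_norm_ge_lt_top ν hr).ne hg.aestronglyMeasurable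
    (.of_forall hC)

theorem measurableSet_norm_ge (r : ℝ) : MeasurableSet {y : Rn n | r ≤ ‖y‖} :=
  measurableSet_le measurable_const measurable_norm

/-- The positive maximum principle for the Lévy operator. -/
theorem C2Bdd.levyExpr_le_of_forall_le (h : C2Bdd w M) {x : Rn n} {r : ℝ} (hr : 0 < r)
    (hx : ∀ y, ‖y‖ < r → w (x + y) ≤ w x) (h0 : 0 ≤ w x) (l : Rn n)
    {Q : Matrix (Fin n) (Fin n) ℝ} (hQ : Q.PosSemidef) :
    levyExpr l Q ν w x ≤ ∫ y in {y | r ≤ ‖y‖}, w (x + y) ∂ν := by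
  have hmax : IsLocalMax w x := by
    filter_upwards [Metric.ball_mem_nhds x hr] with z hz
    simpa using hx (z - x) (mem_ball_iff_norm.1 hz)
  have hd : fderiv ℝ w x = 0 := hmax.fderiv_eq_zero
  have hdiv := h.divGrad_nonpos_of_isLocalMax hmax hQ
  have hj : ∫ y in {y : Rn n | y ≠ 0}, levyJump w x y ∂ν
      ≤ ∫ y in {y | r ≤ ‖y‖}, w (x + y) ∂ν := by
    have hi : Integrable ({y | r ≤ ‖y‖}.indicator fun y => w (x + y)) ν :=
      (integrable_indicator_iff (measurableSet_norm_ge r)).2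
        (integrableOn_norm_ge (h.contDiff.continuous.comp (continuous_const_add x))
          (fun y => h.norm_le _) hr)
    have hs : {y : Rn n | y ≠ 0} ∩ {y | r ≤ ‖y‖} = {y | r ≤ ‖y‖} :=
      Set.inter_eq_right.2 fun y (hy : r ≤ ‖y‖) => norm_pos_iff.1 (hr.trans_le hy)
    calc ∫ y in {y : Rn n | y ≠ 0}, levyJump w x y ∂ν
        ≤ ∫ y in {y : Rn n | y ≠ 0}, {y | r ≤ ‖y‖}.indicator (fun y => w (x + y)) y ∂ν := by
          refine setIntegral_mono (h.integrable_levyJump x).integrableOn hi.integrableOn fun y => ?_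
          have : levyJump w x y = w (x + y) - w x := by simp [levyJump, hd]
          rw [this, Set.indicator]
          split_ifs with hy
          · linarith
          · linarith [hx y (not_le.1 hy)]
      _ = ∫ y in {y | r ≤ ‖y‖}, w (x + y) ∂ν := by
          rw [setIntegral_indicator (measurableSet_norm_ge r), hs]
  rw [levyExpr_eq, hd, zero_apply]
  linarith

theorem continuous_setIntegral_norm_ge (u : C₀(Rn n, ℝ)) {r : ℝ} (hr : 0 < r) :
    Continuous fun x => ∫ y in {y | r ≤ ‖y‖}, u (x + y) ∂ν := by
  obtain ⟨C, hC⟩ := (ZeroAtInftyContinuousMap.isBounded_range u).exists_norm_le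
  have hC' : ∀ x, ‖u x‖ ≤ C := fun x => hC _ ⟨x, rfl⟩
  have hu : Continuous u := u.continuous
  refine continuous_of_dominated (bound := fun _ => C) (fun x => by fun_prop)
    (fun x => .of_forall fun y => hC' _) ?_ (.of_forall fun y => by fun_prop)
  exact integrableOn_const (measure_norm_ge_lt_top ν hr).ne

/-- If the inequality failed at `x₀`, it would fail by a margin `η` on a small ball. Adding `δχ` to
an approximant forces a local maximum inside that ball, where the maximum principle contradicts the
margin once `δ` is small. -/
theorem le_setIntegral_of_tendstoUniformly (l : Rn n) {Q : Matrix (Fin n) (Fin n) ℝ}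
    (hQ : Q.PosSemidef) {u f : C₀(Rn n, ℝ)} {v : ℕ → Rn n → ℝ}
    (hv : ∀ k, ContDiff ℝ ∞ (v k) ∧ HasCompactSupport (v k)) (hvu : TendstoUniformly v u atTop)
    (hvf : TendstoUniformly (fun k => levyExpr l Q ν (v k)) f atTop) {x₀ : Rn n} {r : ℝ}
    (hr : 0 < r) (hu : ∀ x ∈ Metric.ball x₀ r, u x = 0) :
    f x₀ ≤ ∫ y in {y | r / 2 ≤ ‖y‖}, u (x₀ + y) ∂ν := by
  set G : Rn n → ℝ := fun x => ∫ y in {y | r / 2 ≤ ‖y‖}, u (x + y) ∂ν with hG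
  have hGc : Continuous G := continuous_setIntegral_norm_ge u (half_pos hr)
  by_contra! hlt
  change G x₀ < f x₀ at hlt
  obtain ⟨η, hη, hη'⟩ : ∃ η > 0, G x₀ + η < f x₀ :=
    ⟨(f x₀ - G x₀) / 2, by linarith, by linarith⟩
  have hopen : IsOpen {x | G x + η < f x} :=
    isOpen_lt (by fun_prop) f.continuous
  obtain ⟨ρ', hρ', hball⟩ := Metric.isOpen_iff.1 hopen x₀ hη'
  obtain ⟨ρ, hρ, hρ₁, hρ₂⟩ : ∃ ρ > 0, ρ ≤ ρ' ∧ ρ < r / 2 :=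
    ⟨min ρ' (r / 4), by positivity, min_le_left _ _, (min_le_right _ _).trans_lt (by linarith)⟩
  let χ : ContDiffBump x₀ := ⟨ρ / 2, ρ, by positivity, by linarith⟩
  have hχ0 : χ x₀ = 1 := χ.one_of_mem_closedBall (Metric.mem_closedBall_self (by positivity))
  have hχz : ∀ x, ρ ≤ dist x x₀ → χ x = 0 := fun x hx => χ.zero_of_le_dist hx
  obtain ⟨Mχ, hMχ⟩ := exists_c2Bdd_of_hasCompactSupport χ.contDiff χ.hasCompactSupport
  obtain ⟨C, hC, hCb⟩ := C2Bdd.exists_norm_levyExpr_le ν l Q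
  set K := C * Mχ
  have hK : 0 ≤ K := mul_nonneg hC hMχ.nonneg
  have hKb : ∀ x, ‖levyExpr l Q ν χ x‖ ≤ K := hCb χ Mχ hMχ
  set m := ν.real {y | r / 2 ≤ ‖y‖} with hm
  have hm0 : 0 ≤ m := measureReal_nonneg
  -- The three error terms are the replacement of `w` by `u` in the integral, the Lévy expression of
  -- `δχ`, and the approximation of `f`. `K` depends on the bump but not on `δ`.
  obtain ⟨δ, hδ, hδη⟩ : ∃ δ > 0, 2 * δ * m + δ * K + δ = η :=
    ⟨η / (2 * m + K + 1), by positivity, by field_simp⟩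
  obtain ⟨k, hk1, hk2⟩ := ((Metric.tendstoUniformly_iff.1 hvu (δ / 4) (by positivity)).and
    (Metric.tendstoUniformly_iff.1 hvf δ hδ)).exists
  obtain ⟨Mv, hMv⟩ := exists_c2Bdd_of_hasCompactSupport (hv k).1 (hv k).2
  have hw := hMv.add_mul hMχ δ
  set w : Rn n → ℝ := fun x => v k x + δ * χ x with hwdef
  have hvuk : ∀ x, |u x - v k x| < δ / 4 := hk1
  have hvz : ∀ x ∈ Metric.ball x₀ r, |v k x| < δ / 4 := fun x hx => by
    simpa [hu x hx] using hvuk x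
  obtain ⟨x, hx, hxmax⟩ := (isCompact_closedBall x₀ ρ).exists_isMaxOn
    ⟨x₀, Metric.mem_closedBall_self hρ.le⟩ hw.contDiff.continuous.continuousOn
  -- At the centre `w ≥ δ - δ/4`, whereas off the bump but within `ball x₀ r` only `w < δ/4` is
  -- possible; so the maximum lies inside the bump.
  have hwx : δ * 3 / 4 < w x := by
    have h1 : w x₀ ≤ w x := hxmax (Metric.mem_closedBall_self hρ.le)
    have h2 := (abs_lt.1 (hvz x₀ (Metric.mem_ball_self hr))).1
    simp only [hwdef, hχ0] at h1 ⊢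
    linarith
  have hout : ∀ z ∈ Metric.ball x₀ r, ρ ≤ dist z x₀ → w z < δ / 4 := fun z hz hzρ => by
    simpa [hwdef, hχz z hzρ] using (abs_lt.1 (hvz z hz)).2
  have hxρ : dist x x₀ < ρ := by
    by_contra! hc
    have := hout x (Metric.mem_ball.2 ((Metric.mem_closedBall.1 hx).trans_lt (by linarith))) hc
    linarith
  have hpmp := hw.levyExpr_le_of_forall_le (ν := ν) (x := x) (half_pos hr) (fun y hy => by
    have hy' : dist (x + y) x₀ < r := by
      have : dist (x + y) x = ‖y‖ := by simp
      linarith [dist_triangle (x + y) x x₀]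
    rcases le_total (dist (x + y) x₀) ρ with h1 | h1
    · exact hxmax (Metric.mem_closedBall.2 h1)
    · have := hout _ (Metric.mem_ball.2 hy') h1
      linarith) (by linarith) l hQ
  have hint : ∫ y in {y | r / 2 ≤ ‖y‖}, w (x + y) ∂ν ≤ G x + 2 * δ * m := by
    obtain ⟨Cu, hCu⟩ := (ZeroAtInftyContinuousMap.isBounded_range u).exists_norm_le
    have hui : IntegrableOn (fun y => u (x + y)) {y | r / 2 ≤ ‖y‖} ν :=
      integrableOn_norm_ge (u.continuous.comp (continuous_const_add x))
        (fun y => hCu _ ⟨x + y, rfl⟩) (half_pos hr)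
    have hconst : IntegrableOn (fun _ : Rn n => 2 * δ) {y | r / 2 ≤ ‖y‖} ν :=
      integrableOn_const (measure_norm_ge_lt_top ν (half_pos hr)).ne
    have : G x + 2 * δ * m = ∫ y in {y | r / 2 ≤ ‖y‖}, (u (x + y) + 2 * δ) ∂ν := by
      rw [integral_add hui hconst, setIntegral_const, smul_eq_mul, hG, hm]
      ring
    rw [this]
    refine setIntegral_mono (integrableOn_norm_ge
      (hw.contDiff.continuous.comp (continuous_const_add x)) (fun y => hw.norm_le _) (half_pos hr))
      (hui.add hconst) fun y => ?_
    have h1 := (abs_lt.1 (hvuk (x + y))).1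
    have h2 : δ * χ (x + y) ≤ δ * 1 := mul_le_mul_of_nonneg_left χ.le_one hδ.le
    simp only [hwdef]
    linarith
  rw [hMv.levyExpr_add_mul hMχ] at hpmp
  have h1 := (abs_lt.1 (hk2 x : |f x - levyExpr l Q ν (v k) x| < δ)).2
  have h2 : -(δ * K) ≤ δ * levyExpr l Q ν χ x := by
    rw [← mul_neg]
    exact mul_le_mul_of_nonneg_left (abs_le.1 (hKb x)).1 hδ.le
  have h3 : G x + η < f x := hball (Metric.mem_ball.2 (hxρ.trans_le hρ₁))
  linarith

/-- On an open set where `u` vanishes, the Lévy operator is given by its non-local part. -/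
theorem eq_setIntegral_of_isLevyOperatorValue {l : Rn n} {Q : Matrix (Fin n) (Fin n) ℝ}
    (hQ : Q.PosSemidef) {u f : C₀(Rn n, ℝ)} (h : IsLevyOperatorValue l Q ν u f) {x₀ : Rn n} {r : ℝ}
    (hr : 0 < r) (hu : ∀ x ∈ Metric.ball x₀ r, u x = 0) :
    f x₀ = ∫ y in {y | r / 2 ≤ ‖y‖}, u (x₀ + y) ∂ν := by
  obtain ⟨v, hv, hvu, hvf⟩ := h
  refine le_antisymm (le_setIntegral_of_tendstoUniformly l hQ hv hvu hvf hr hu) ?_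
  have hneg : ∀ k, levyExpr l Q ν (-v k) = -levyExpr l Q ν (v k) := fun k => by
    obtain ⟨M, hM⟩ := exists_c2Bdd_of_hasCompactSupport (hv k).1 (hv k).2
    have h2 : -v k = fun x => v k x + (-2) * v k x := by ext x; simp; ring
    ext x
    rw [h2, hM.levyExpr_add_mul hM]
    simp; ring
  have := le_setIntegral_of_tendstoUniformly (ν := ν) (x₀ := x₀) (r := r) (u := -u) (f := -f)
    (v := fun k => -v k) l hQ
    (fun k => ⟨(hv k).1.neg, (hv k).2.neg⟩)
    (by simpa [Metric.tendstoUniformly_iff, dist_neg_neg] using! hvu)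
    (by simpa [Metric.tendstoUniformly_iff, dist_neg_neg, hneg] using! hvf)
    hr (fun x hx => by simp [hu x hx])
  simp only [ZeroAtInftyContinuousMap.neg_apply, integral_neg] at this
  linarith

end MaximumPrinciple

/-! ### Mollifications lie in the domain -/

section Mollification

open scoped Convolution

variable {n : ℕ}

/-- General target spaces are needed because the kernel is also replaced by its first and second
Fréchet derivatives. -/
theorem norm_convolution_le {E' F : Type*} [NormedAddCommGroup E'] [NormedSpace ℝ E']
    [NormedAddCommGroup F] [NormedSpace ℝ F] {k : Rn n → E'} (hk : Continuous k)
    (hks : HasCompactSupport k) (L : E' →L[ℝ] ℝ →L[ℝ] F) {w : Rn n → ℝ} {B : ℝ}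
    (hB : ∀ x, ‖w x‖ ≤ B) (x : Rn n) :
    ‖(k ⋆[L, volume] w) x‖ ≤ ‖L‖ * (∫ t, ‖k t‖) * B := by
  rw [convolution_def, ← integral_const_mul, ← integral_mul_const]
  refine norm_integral_le_of_norm_le
    (((hk.integrable_of_hasCompactSupport hks).norm.const_mul _).mul_const _)
    (.of_forall fun t => ?_)
  refine (L.le_opNorm₂ _ _).trans ?_
  gcongr
  exact hB _

/-- The regularization of `w` by the normalized bump function `χ`. -/
def mollify (χ : ContDiffBump (0 : Rn n)) (w : Rn n → ℝ) : Rn n → ℝ :=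
  χ.normed volume ⋆[ContinuousLinearMap.lsmul ℝ ℝ, volume] w

variable (χ : ContDiffBump (0 : Rn n))

theorem mollify_apply (w : Rn n → ℝ) (x : Rn n) :
    mollify χ w x = ∫ t, χ.normed volume t * w (x - t) := rfl

theorem contDiff_mollify {w : Rn n → ℝ} (hw : Continuous w) : ContDiff ℝ ∞ (mollify χ w) :=
  χ.hasCompactSupport_normed.contDiff_convolution_left _ χ.contDiff_normed hw.locallyIntegrable

theorem hasCompactSupport_mollify {w : Rn n → ℝ} (hw : HasCompactSupport w) :
    HasCompactSupport (mollify χ w) :=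
  χ.hasCompactSupport_normed.convolution _ hw

theorem mollify_add {w w' : Rn n → ℝ} (hw : Continuous w) (hw' : Continuous w') :
    mollify χ (w + w') = mollify χ w + mollify χ w' :=
  ConvolutionExists.distrib_add
    (χ.hasCompactSupport_normed.convolutionExists_left _ χ.continuous_normed hw.locallyIntegrable)
    (χ.hasCompactSupport_normed.convolutionExists_left _ χ.continuous_normed hw'.locallyIntegrable)

set_option maxSynthPendingDepth 3 in
-- All derivatives fall on the kernel, so the constant depends only on `χ` and the sup norm of `w`
-- controls the `C²` norm of its mollification.
theorem exists_c2Bdd_mollify : ∃ C, 0 ≤ C ∧ ∀ (w : Rn n → ℝ) (B : ℝ), Continuous w →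
    (∀ x, ‖w x‖ ≤ B) → C2Bdd (mollify χ w) (C * B) := by
  set k : Rn n → ℝ := χ.normed volume with hkdef
  have hk : ContDiff ℝ 2 k := χ.contDiff_normed (n := 2)
  have hks : HasCompactSupport k := χ.hasCompactSupport_normed
  have hk1 : ContDiff ℝ 1 (fderiv ℝ k) := hk.fderiv_right (by norm_num)
  set L₀ : ℝ →L[ℝ] ℝ →L[ℝ] ℝ := ContinuousLinearMap.lsmul ℝ ℝ
  set L₁ := L₀.precompL (Rn n)
  set L₂ := L₁.precompL (Rn n)
  set C₀ := ‖L₀‖ * ∫ t, ‖k t‖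
  set C₁ := ‖L₁‖ * ∫ t, ‖fderiv ℝ k t‖
  set C₂ := ‖L₂‖ * ∫ t, ‖fderiv ℝ (fderiv ℝ k) t‖
  have h₀ : 0 ≤ C₀ := mul_nonneg (norm_nonneg _) (integral_nonneg fun _ => norm_nonneg _)
  refine ⟨max C₀ (max C₁ C₂), h₀.trans (le_max_left _ _), fun w B hw hB => ?_⟩
  have hB0 : 0 ≤ B := (norm_nonneg _).trans (hB 0)
  have hd1 : fderiv ℝ (mollify χ w) = fderiv ℝ k ⋆[L₁, volume] w := funext fun x =>
    (hks.hasFDerivAt_convolution_left L₀ (hk.of_le (by norm_num)) hw.locallyIntegrable x).fderiv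
  have hd2 : fderiv ℝ (fderiv ℝ (mollify χ w)) = fderiv ℝ (fderiv ℝ k) ⋆[L₂, volume] w := by
    rw [hd1]
    exact funext fun x =>
      ((hks.fderiv ℝ).hasFDerivAt_convolution_left L₁ hk1 hw.locallyIntegrable x).fderiv
  refine ⟨(contDiff_mollify χ hw).of_le (by norm_cast), fun x => ?_, fun x => ?_, fun x => ?_⟩
  · refine (norm_convolution_le hk.continuous hks L₀ hB x).trans ?_
    gcongr
    exact le_max_left _ _
  · rw [hd1]
    refine (norm_convolution_le hk1.continuous (hks.fderiv ℝ) L₁ hB x).trans ?_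
    gcongr
    exact (le_max_left C₁ C₂).trans (le_max_right _ _)
  · rw [hd2]
    refine (norm_convolution_le (hk1.continuous_fderiv (by norm_num))
      ((hks.fderiv ℝ).fderiv ℝ) L₂ hB x).trans ?_
    gcongr
    exact (le_max_right C₁ C₂).trans (le_max_right _ _)

theorem ZeroAtInftyContinuousMap.exists_hasCompactSupport_norm_sub_le (u : C₀(Rn n, ℝ)) {η : ℝ}
    (hη : 0 < η) :
    ∃ w : Rn n → ℝ, Continuous w ∧ HasCompactSupport w ∧ ∀ x, ‖u x - w x‖ ≤ η := by
  have h := u.zero_at_infty'.eventually (Metric.ball_mem_nhds 0 hη)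
  rw [← Metric.cobounded_eq_cocompact, ← comap_norm_atTop, eventually_comap] at h
  obtain ⟨R, hR⟩ := eventually_atTop.1 h
  let θ : ContDiffBump (0 : Rn n) := ⟨max R 1, max R 1 + 1, by positivity, by linarith⟩
  refine ⟨fun x => θ x * u x, θ.continuous.mul u.continuous, θ.hasCompactSupport.mul_right,
    fun x => ?_⟩
  have h1 : u x - θ x * u x = (1 - θ x) * u x := by ring
  have h2 : ‖1 - θ x‖ ≤ 1 := by
    rw [Real.norm_eq_abs, abs_le]
    constructor <;> linarith [θ.nonneg (x := x), θ.le_one (x := x)]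
  change ‖u x - θ x * u x‖ ≤ η
  rcases le_or_gt ‖x‖ (max R 1) with hx | hx
  · rw [h1, θ.one_of_mem_closedBall (mem_closedBall_zero_iff.2 hx)]
    simpa using hη.le
  · have h3 := hR ‖x‖ ((le_max_left _ _).trans hx.le) x rfl
    rw [h1, norm_mul]
    have h4 : ‖u x‖ < η := mem_ball_zero_iff.1 h3
    nlinarith [norm_nonneg (u x)]

theorem TendstoUniformly.tendsto_zero {α : Type*} {F : ℕ → α → ℝ} {f : α → ℝ} {p : Filter α}
    (h : TendstoUniformly F f atTop) (hF : ∀ k, Tendsto (F k) p (𝓝 0)) : Tendsto f p (𝓝 0) := by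
  rw [Metric.tendsto_nhds]
  intro ε hε
  obtain ⟨k, hk⟩ := (Metric.tendstoUniformly_iff.1 h (ε / 2) (half_pos hε)).exists
  filter_upwards [Metric.tendsto_nhds.1 (hF k) (ε / 2) (half_pos hε)] with x hx
  linarith [dist_triangle (f x) (F k x) 0, hk x]

variable {ν : Measure (Rn n)} [IsLevyMeasure ν]

/-- Regularizations of functions vanishing at infinity belong to the domain of the Lévy operator,
which acts on them by `levyExpr`. -/
theorem exists_isLevyOperatorValue_mollify (l : Rn n) (Q : Matrix (Fin n) (Fin n) ℝ)
    (u : C₀(Rn n, ℝ)) : ∃ U f : C₀(Rn n, ℝ), ⇑U = mollify χ u ∧ ⇑f = levyExpr l Q ν (mollify χ u) ∧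
      IsLevyOperatorValue l Q ν U f := by
  obtain ⟨C, hC, hCb⟩ := exists_c2Bdd_mollify χ
  obtain ⟨D, hD, hDb⟩ := C2Bdd.exists_norm_levyExpr_le ν l Q
  -- Mollifying compactly supported approximants of `u` gives the test functions that witness
  -- membership in the closure.
  choose w hwc hws hwu using fun k : ℕ =>
    u.exists_hasCompactSupport_norm_sub_le (Nat.one_div_pos_of_nat (α := ℝ) (n := k))
  have huc : Continuous u := u.continuous
  have hdiff : ∀ k, C2Bdd (mollify χ (⇑u - w k)) (C * (1 / ((k : ℝ) + 1))) := fun k =>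
    hCb _ _ (huc.sub (hwc k)) (hwu k)
  have hv : ∀ k, ContDiff ℝ ∞ (mollify χ (w k)) ∧ HasCompactSupport (mollify χ (w k)) := fun k =>
    ⟨contDiff_mollify χ (hwc k), hasCompactSupport_mollify χ (hws k)⟩
  have hsum : ∀ k, mollify χ u = fun x => mollify χ (w k) x + 1 * mollify χ (⇑u - w k) x := by
    intro k
    conv_lhs => rw [← add_sub_cancel (w k) ⇑u, mollify_add χ (hwc k) (huc.sub (hwc k))]
    ext x
    simp
  have hlevy : ∀ k x, levyExpr l Q ν (mollify χ u) x - levyExpr l Q ν (mollify χ (w k)) x =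
      levyExpr l Q ν (mollify χ (⇑u - w k)) x := fun k x => by
    obtain ⟨M, hM⟩ := exists_c2Bdd_of_hasCompactSupport (hv k).1 (hv k).2
    rw [hsum k, hM.levyExpr_add_mul (hdiff k)]
    ring
  have hlim : ∀ c : ℝ, Tendsto (fun k : ℕ => c * (1 / ((k : ℝ) + 1))) atTop (𝓝 0) := fun c => by
    simpa using tendsto_one_div_add_atTop_nhds_zero_nat.const_mul c
  have t1 : TendstoUniformly (fun k => mollify χ (w k)) (mollify χ u) atTop := by
    rw [Metric.tendstoUniformly_iff]
    intro ε hε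
    filter_upwards [(hlim C).eventually (gt_mem_nhds hε)] with k hk x
    rw [dist_eq_norm]
    refine lt_of_le_of_lt ?_ hk
    have : mollify χ u x - mollify χ (w k) x = mollify χ (⇑u - w k) x := by
      rw [congrFun (hsum k) x]; ring
    rw [this]
    exact (hdiff k).norm_le x
  have t2 : TendstoUniformly (fun k => levyExpr l Q ν (mollify χ (w k)))
      (levyExpr l Q ν (mollify χ u)) atTop := by
    rw [Metric.tendstoUniformly_iff]
    intro ε hε
    filter_upwards [(hlim (D * C)).eventually (gt_mem_nhds hε)] with k hk x
    rw [dist_eq_norm, hlevy]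
    refine lt_of_le_of_lt ?_ hk
    rw [mul_assoc]
    exact hDb _ _ (hdiff k) x
  obtain ⟨B, hB⟩ := (ZeroAtInftyContinuousMap.isBounded_range u).exists_norm_le
  refine ⟨⟨⟨mollify χ u, (contDiff_mollify χ huc).continuous⟩,
      t1.tendsto_zero fun k => (hv k).2.tendsto_cocompact_zero⟩,
    ⟨⟨levyExpr l Q ν (mollify χ u),
      (hCb u B huc fun x => hB _ ⟨x, rfl⟩).continuous_levyExpr l Q⟩,
      t2.tendsto_zero fun k => tendsto_levyExpr_cocompact (hv k).1 (hv k).2 l Q⟩, rfl, rfl,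
    fun k => mollify χ (w k), hv, t1, t2⟩

theorem mollify_eq_zero {w : Rn n → ℝ} {x : Rn n}
    (h : ∀ z ∈ Metric.ball x χ.rOut, w z = 0) : mollify χ w x = 0 := by
  rw [mollify_apply]
  refine integral_eq_zero_of_ae (.of_forall fun t => ?_)
  by_cases ht : t ∈ Metric.ball 0 χ.rOut
  · have : w (x - t) = 0 := h _ (by simpa using ht)
    simp [this]
  · have : χ.normed volume t = 0 := by
      rwa [← Function.notMem_support, χ.support_normed_eq]
    simp [this]

theorem setIntegral_mollify (u : C₀(Rn n, ℝ)) {r : ℝ} (hr : 0 < r) (x : Rn n) :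
    ∫ y in {y | r ≤ ‖y‖}, mollify χ u (x + y) ∂ν =
      ∫ t, χ.normed volume t * ∫ y in {y | r ≤ ‖y‖}, u (x - t + y) ∂ν := by
  have : IsFiniteMeasure (ν.restrict {y | r ≤ ‖y‖}) :=
    isFiniteMeasure_restrict.2 (measure_norm_ge_lt_top ν hr).ne
  have huc : Continuous u := u.continuous
  obtain ⟨B, hB⟩ := (ZeroAtInftyContinuousMap.isBounded_range u).exists_norm_le
  have hint : Integrable (Function.uncurry fun y t => χ.normed volume t * u (x + y - t))
      ((ν.restrict {y | r ≤ ‖y‖}).prod volume) := by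
    refine (((integrable_const (1 : ℝ)).mul_prod
      (χ.integrable_normed (μ := volume))).mul_const B).mono' ?_ (.of_forall fun p => ?_)
    · have := χ.continuous_normed (μ := (volume : Measure (Rn n)))
      exact Continuous.aestronglyMeasurable (by fun_prop)
    · simp only [Function.uncurry, norm_mul, one_mul]
      rw [Real.norm_of_nonneg (χ.nonneg_normed _)]
      exact mul_le_mul_of_nonneg_left (hB _ ⟨_, rfl⟩) (χ.nonneg_normed _)
  simp only [mollify_apply]
  rw [integral_integral_swap hint]
  refine integral_congr_ae (.of_forall fun t => ?_)
  simp only [integral_const_mul, sub_add_eq_add_sub]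

/-- If `u` vanishes near the origin and is annihilated by the translates of the Lévy measure, then
so are its regularizations on a smaller ball. -/
theorem levyExpr_mollify_eq_zero (l : Rn n) (Q : Matrix (Fin n) (Fin n) ℝ) {u : C₀(Rn n, ℝ)}
    {ε : ℝ} (hε : 0 < ε) (hu : ∀ x ∈ Metric.ball 0 ε, u x = 0)
    (hν : ∀ x ∈ Metric.ball 0 ε, ∫ y, u (x + y) ∂ν = 0) (hχ : χ.rOut ≤ ε / 4) {x : Rn n}
    (hx : x ∈ Metric.ball 0 (ε / 2)) : levyExpr l Q ν (mollify χ u) x = 0 := by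
  -- Radii: mollifying costs at most `ε/4`, and `3ε/4` leaves room for `‖x‖ < ε/2` plus a jump
  -- shorter than `ε/4`.
  have hz : ∀ z ∈ Metric.ball (0 : Rn n) (3 * ε / 4), mollify χ u z = 0 := fun z hz =>
    mollify_eq_zero χ fun t ht => hu t (by
      rw [mem_ball_zero_iff] at hz ⊢
      have := norm_le_norm_add_norm_sub' t z
      linarith [mem_ball_iff_norm.1 ht])
  have hnear : mollify χ u =ᶠ[𝓝 x] fun _ => 0 := by
    filter_upwards [Metric.isOpen_ball.mem_nhds hx] with z hzx
    exact hz z (Metric.ball_subset_ball (by linarith) hzx)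
  have hd : fderiv ℝ (mollify χ u) x = 0 := by
    rw [hnear.fderiv_eq]; simp
  have hd2 : fderiv ℝ (fderiv ℝ (mollify χ u)) x = 0 := by
    rw [hnear.fderiv.fderiv_eq]; simp
  have huc : Continuous u := u.continuous
  have hsm : ContDiff ℝ 2 (mollify χ u) := (contDiff_mollify χ huc).of_le (by norm_cast)
  have hdiv : divGrad Q (mollify χ u) x = 0 := by
    rw [divGrad_eq ((hsm.fderiv_right (m := 1) (by norm_num)).differentiable (by norm_num)), hd2]
    simp
  rw [mem_ball_zero_iff] at hx
  have hj : ∀ y, levyJump (mollify χ u) x y =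
      {y | ε / 4 ≤ ‖y‖}.indicator (fun y => mollify χ u (x + y)) y := fun y => by
    have h0 : levyJump (mollify χ u) x y = mollify χ u (x + y) := by
      simp [levyJump, hd, hnear.eq_of_nhds]
    rw [h0, Set.indicator]
    split_ifs with hy
    · rfl
    · refine hz _ (mem_ball_zero_iff.2 ?_)
      have hy' : ‖y‖ < ε / 4 := not_le.1 hy
      linarith [norm_add_le x y]
  have hs : {y : Rn n | y ≠ 0} ∩ {y | ε / 4 ≤ ‖y‖} = {y | ε / 4 ≤ ‖y‖} :=
    Set.inter_eq_right.2 fun y (hy : ε / 4 ≤ ‖y‖) => norm_pos_iff.1 (by linarith)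
  rw [levyExpr_eq, hd, hdiv, funext hj, setIntegral_indicator (measurableSet_norm_ge _), hs,
    setIntegral_mollify χ u (by linarith)]
  have : ∀ t, χ.normed volume t * ∫ y in {y | ε / 4 ≤ ‖y‖}, u (x - t + y) ∂ν = 0 := fun t => by
    by_cases ht : t ∈ Metric.ball 0 χ.rOut
    · rw [mem_ball_zero_iff] at ht
      have hxt : ‖x - t‖ < 3 * ε / 4 := by linarith [norm_sub_le x t]
      -- The jumps below `ε/4` contribute nothing, so the truncated integral equals the full one,
      -- which vanishes at `x - t` by `hν`.
      rw [setIntegral_eq_integral_of_forall_compl_eq_zero fun y hy => ?_,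
        hν _ (mem_ball_zero_iff.2 (by linarith)), mul_zero]
      have hy' : ‖y‖ < ε / 4 := not_le.1 hy
      exact hu _ (mem_ball_zero_iff.2 (by linarith [norm_add_le (x - t) y]))
    · have : χ.normed volume t = 0 := by
        rwa [← Function.notMem_support, χ.support_normed_eq]
      rw [this, zero_mul]
  simp [this]

end Mollification

/-! ### Extension by zero and restriction of functions vanishing at infinity -/

section Extension

variable {X : Type*} [TopologicalSpace X]

theorem ZeroAtInftyContinuousMap.exists_isCompact_forall_norm_lt (u : C₀(X, ℝ)) {η : ℝ}
    (hη : 0 < η) : ∃ K : Set X, IsCompact K ∧ ∀ x ∉ K, ‖u x‖ < η := by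
  obtain ⟨K, hK, hKs⟩ := mem_cocompact.1 (u.zero_at_infty' (Metric.ball_mem_nhds 0 hη))
  exact ⟨K, hK, fun x hx => mem_ball_zero_iff.1 (hKs hx)⟩

theorem tendsto_cocompact_zero_of_forall_isCompact {u : X → ℝ}
    (h : ∀ η > 0, ∃ K : Set X, IsCompact K ∧ ∀ x ∉ K, ‖u x‖ < η) :
    Tendsto u (cocompact X) (𝓝 0) := by
  rw [Metric.tendsto_nhds]
  intro η hη
  obtain ⟨K, hK, hKs⟩ := h η hη
  filter_upwards [hK.compl_mem_cocompact] with x hx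
  simpa using hKs x hx

variable {s : Set X}

/-- A function vanishing at infinity on an open set extends by zero to the whole space. -/
theorem ZeroAtInftyContinuousMap.exists_extension [T2Space X] (hs : IsOpen s) (φ : C₀(s, ℝ)) :
    ∃ u : C₀(X, ℝ), (∀ z : s, u z = φ z) ∧ ∀ z ∉ s, u z = 0 := by
  classical
  set u : X → ℝ := fun z => if hz : z ∈ s then φ ⟨z, hz⟩ else 0 with hu
  have hus : ∀ z : s, u z = φ z := fun z => by simp [hu]
  have hu0 : ∀ z ∉ s, u z = 0 := fun z hz => by simp [hu, hz]
  -- The inclusion `K ⊆ s` gives continuity off `s`: the complement of `K` is a neighbourhood of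
  -- each such point on which `‖u‖ < η`.
  have hK : ∀ η > 0, ∃ K : Set X, IsCompact K ∧ K ⊆ s ∧ ∀ x ∉ K, ‖u x‖ < η := fun η hη => by
    obtain ⟨K, hK, hKφ⟩ := φ.exists_isCompact_forall_norm_lt hη
    refine ⟨Subtype.val '' K, hK.image continuous_subtype_val, Subtype.coe_image_subset s K,
      fun x hx => ?_⟩
    by_cases hxs : x ∈ s
    · rw [hus ⟨x, hxs⟩]
      exact hKφ _ fun h => hx ⟨_, h, rfl⟩
    · simpa [hu0 x hxs] using hη
  refine ⟨⟨⟨u, ?_⟩, tendsto_cocompact_zero_of_forall_isCompact fun η hη => ?_⟩, hus, hu0⟩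
  · refine continuous_iff_continuousAt.2 fun z => ?_
    by_cases hz : z ∈ s
    · refine (hs.isOpenEmbedding_subtypeVal.continuousAt_iff (x := ⟨z, hz⟩)).1 ?_
      exact (φ.continuous.congr fun z => (hus z).symm).continuousAt
    · rw [Metric.continuousAt_iff']
      intro η hη
      obtain ⟨K, hKc, hKs, hKu⟩ := hK η hη
      filter_upwards [hKc.isClosed.isOpen_compl.mem_nhds fun h => hz (hKs h)] with x hx
      simpa [hu0 z hz] using hKu x hx
  · obtain ⟨K, hKc, -, hKu⟩ := hK η hη
    exact ⟨K, hKc, hKu⟩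

/-- A function vanishing at infinity and outside of a set `s` restricts to a function on `s`
vanishing at infinity. -/
theorem ZeroAtInftyContinuousMap.exists_restriction (u : C₀(X, ℝ)) (hu : ∀ z ∉ s, u z = 0) :
    ∃ φ : C₀(s, ℝ), ∀ z : s, φ z = u z := by
  have huc : Continuous u := u.continuous
  refine ⟨⟨⟨fun z => u z, by fun_prop⟩, tendsto_cocompact_zero_of_forall_isCompact
    fun η hη => ?_⟩, fun _ => rfl⟩
  obtain ⟨K, hK, hKu⟩ := u.exists_isCompact_forall_norm_lt hη
  -- Unlike `K`, the superlevel set is contained in `s`, so it stays compact in the subtype.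
  have hc : IsCompact {x | η ≤ ‖u x‖} :=
    hK.of_isClosed_subset (isClosed_le continuous_const huc.norm) fun x hx => by
      by_contra h
      exact absurd (hKu x h) (not_lt.2 hx)
  refine ⟨Subtype.val ⁻¹' {x | η ≤ ‖u x‖}, ?_, fun x hx => not_le.1 hx⟩
  rw [Topology.IsInducing.subtypeVal.isCompact_iff, Subtype.image_preimage_coe,
    Set.inter_eq_right.2]
  · exact hc
  · intro x hx
    by_contra h
    have : η ≤ ‖u x‖ := hx
    rw [hu x h, norm_zero] at this
    linarith

end Extension

/-! ### From annihilators to unique continuation and back -/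

variable {n : ℕ} {ν : Measure (Rn n)} [IsLevyMeasure ν]

/-- The sign `-x` arises because the shifted measure is the push-forward of `ν` under `y ↦ y - x`;
the symmetry of the ball absorbs it later. -/
theorem integral_shiftRestrict {ε : ℝ} (x : Metric.ball (0 : Rn n) ε) {u : C₀(Rn n, ℝ)}
    (hu : ∀ z ∉ extDomain n ε, u z = 0) {φ : C₀(extDomain n ε, ℝ)} (hφ : ∀ z, φ z = u z) :
    ∫ᵛ z, φ z ∂<•(shiftRestrict ν ε x).toSignedMeasure = ∫ y, u (-x + y) ∂ν := by
  have hO : MeasurableSet (extDomain n ε) := Metric.isClosed_closedBall.measurableSet.compl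
  have huc : Continuous u := u.continuous
  rw [VectorMeasure.integral_toSignedMeasure, shiftRestrict]
  simp only [hφ]
  rw [integral_subtype_comap hO, setIntegral_eq_integral_of_forall_compl_eq_zero hu,
    integral_map (by fun_prop) huc.aestronglyMeasurable]
  simp only [sub_eq_neg_add]

/-- The span of the shifted Lévy measures is vaguely dense if and only if a function vanishing at
infinity and on the ball is zero as soon as the non-local part of the Lévy operator maps it to a
function vanishing on the ball. -/
theorem dense_shiftedLevyMeasures_iff (ε : ℝ) :
    @Dense (SignedMeasure (extDomain n ε)) (vagueTopology (extDomain n ε))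
      (Submodule.span ℝ (shiftedLevyMeasures ν ε) : Set (SignedMeasure (extDomain n ε))) ↔
    ∀ u : C₀(Rn n, ℝ), (∀ z ∈ Metric.closedBall 0 ε, u z = 0) →
      (∀ x ∈ Metric.ball 0 ε, ∫ y, u (x + y) ∂ν = 0) → u = 0 := by
  have hneg : ∀ x ∈ Metric.ball (0 : Rn n) ε, -x ∈ Metric.ball 0 ε := fun x hx => by
    simpa using hx
  rw [dense_span_vagueTopology_iff]
  constructor
  · intro h u hu hν
    have hu' : ∀ z ∉ extDomain n ε, u z = 0 := fun z hz => hu z (not_not.1 hz)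
    obtain ⟨φ, hφ⟩ := u.exists_restriction hu'
    have h0 := h φ (by
      rintro _ ⟨x, rfl⟩
      rw [integral_shiftRestrict x hu' hφ]
      exact hν _ (hneg x x.2))
    ext z
    by_cases hz : z ∈ extDomain n ε
    · rw [← hφ ⟨z, hz⟩, h0]
      rfl
    · exact hu' z hz
  · intro h φ hφ
    obtain ⟨u, hus, hu0⟩ := φ.exists_extension Metric.isClosed_closedBall.isOpen_compl
    have h0 := h u (fun z hz => hu0 z (not_not.2 hz)) fun x hx => by
      have := hφ _ ⟨⟨-x, hneg x hx⟩, rfl⟩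
      rwa [integral_shiftRestrict _ hu0 fun z => (hus z).symm, neg_neg] at this
    ext z
    rw [← hus, h0]
    rfl

/-- Unique continuation is applied to mollifications of `u` on the half-size ball; they all vanish,
and letting the mollification radius tend to zero gives `u = 0`. -/
theorem HasUCP.eq_zero_of_integral_eq_zero {l : Rn n} {Q : Matrix (Fin n) (Fin n) ℝ}
    (h : HasUCP l Q ν) {ε : ℝ} (hε : 0 < ε) {u : C₀(Rn n, ℝ)}
    (hu : ∀ z ∈ Metric.closedBall 0 ε, u z = 0)
    (hν : ∀ x ∈ Metric.ball 0 ε, ∫ y, u (x + y) ∂ν = 0) : u = 0 := by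
  have hu' : ∀ z ∈ Metric.ball 0 ε, u z = 0 := fun z hz => hu z (Metric.ball_subset_closedBall hz)
  have hzero : ∀ χ : ContDiffBump (0 : Rn n), χ.rOut ≤ ε / 4 → mollify χ u = 0 := by
    intro χ hχ
    obtain ⟨U, f, hU, hf, hUf⟩ := exists_isLevyOperatorValue_mollify (ν := ν) χ l Q u
    have := h (Metric.ball 0 (ε / 2)) Metric.isOpen_ball (Metric.nonempty_ball.2 (half_pos hε))
      U f hUf (fun x hx => by
        rw [hf]
        exact levyExpr_mollify_eq_zero χ l Q hε hu' hν hχ hx)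
      (fun x hx => by
        rw [hU]
        refine mollify_eq_zero χ fun z hz => hu' z ?_
        rw [mem_ball_zero_iff] at hx ⊢
        have := norm_le_norm_add_norm_sub' z x
        linarith [mem_ball_iff_norm.1 hz])
    rw [← hU, this]
    rfl
  let χ : ℕ → ContDiffBump (0 : Rn n) := fun k =>
    ⟨ε / 8 * (1 / ((k : ℝ) + 1)), ε / 4 * (1 / ((k : ℝ) + 1)), by positivity, by
      gcongr; norm_num⟩
  have hχ : Tendsto (fun k => (χ k).rOut) atTop (𝓝 0) := by
    have := tendsto_one_div_add_atTop_nhds_zero_nat.const_mul (ε / 4)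
    rwa [mul_zero] at this
  have hle : ∀ k, (χ k).rOut ≤ ε / 4 := fun k => by
    refine mul_le_of_le_one_right (by positivity) ?_
    rw [div_le_one (by positivity)]
    linarith [(k.cast_nonneg : (0 : ℝ) ≤ k)]
  ext x
  have ht := ContDiffBump.convolution_tendsto_right_of_continuous (μ := volume) hχ u.continuous x
  refine tendsto_nhds_unique ht (tendsto_const_nhds.congr fun k => ?_)
  exact (congrFun (hzero (χ k) (hle k)) x).symm

/-- Translating a point of `G` to the origin reduces to a ball. Halving its radius keeps a full ball
of zeros around every point of the smaller one, as the formula for `Au` requires. -/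
theorem hasUCP_of_forall_eq_zero {l : Rn n} {Q : Matrix (Fin n) (Fin n) ℝ} (hQ : Q.PosSemidef)
    (h : ∀ ε : ℝ, 0 < ε → ∀ u : C₀(Rn n, ℝ), (∀ z ∈ Metric.closedBall 0 ε, u z = 0) →
      (∀ x ∈ Metric.ball 0 ε, ∫ y, u (x + y) ∂ν = 0) → u = 0) : HasUCP l Q ν := by
  rintro G hG ⟨x₀, hx₀⟩ u f huf hf hu
  obtain ⟨r, hr, hrG⟩ := Metric.isOpen_iff.1 hG x₀ hx₀
  let u' : C₀(Rn n, ℝ) :=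
    ⟨⟨fun z => u (x₀ + z), u.continuous.comp (continuous_const_add x₀)⟩,
      u.zero_at_infty'.comp (Homeomorph.addLeft x₀).isClosedEmbedding.tendsto_cocompact⟩
  have hu' : u' = 0 := by
    refine h (r / 2) (half_pos hr) u' (fun z hz => ?_) fun x hx => ?_
    · refine hu _ (hrG ?_)
      rw [mem_closedBall_zero_iff] at hz
      simp only [mem_ball_iff_norm, add_sub_cancel_left]
      linarith
    · rw [mem_ball_zero_iff] at hx
      have hball : ∀ z ∈ Metric.ball (x₀ + x) (r / 2), z ∈ G := fun z hz => hrG (by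
        rw [mem_ball_iff_norm] at hz ⊢
        have : z - x₀ = z - (x₀ + x) + x := by abel
        rw [this]
        linarith [norm_add_le (z - (x₀ + x)) x])
      have key := eq_setIntegral_of_isLevyOperatorValue hQ huf (half_pos hr)
        fun z hz => hu z (hball z hz)
      rw [hf _ (hball _ (Metric.mem_ball_self (half_pos hr))),
        setIntegral_eq_integral_of_forall_compl_eq_zero fun y hy => ?_] at key
      · rw [key]
        exact integral_congr_ae (.of_forall fun y => by
          change u (x₀ + (x + y)) = u (x₀ + x + y)
          rw [add_assoc])
      · refine hu _ (hball _ ?_)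
        have hy' : ‖y‖ < r / 2 / 2 := not_le.1 hy
        simp only [mem_ball_iff_norm, add_sub_cancel_left]
        linarith
  ext x
  have := DFunLike.congr_fun hu' (x - x₀)
  change u (x₀ + (x - x₀)) = 0 at this
  rwa [add_sub_cancel] at this

end

theorem theorem2p3 (n : ℕ) (l : Rn n) (Q : Matrix (Fin n) (Fin n) ℝ) (hQ : Q.PosSemidef)
    (ν : Measure (Rn n)) [IsLevyMeasure ν] :
    HasUCP l Q ν ↔
      ∀ ε : ℝ, 0 < ε →
        @Dense (SignedMeasure (extDomain n ε)) (vagueTopology (extDomain n ε))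
          (Submodule.span ℝ (shiftedLevyMeasures ν ε) :
            Set (SignedMeasure (extDomain n ε))) :=
  ⟨fun h ε hε => (dense_shiftedLevyMeasures_iff ε).2 fun _ hu hν =>
      h.eq_zero_of_integral_eq_zero hε hu hν,
    fun h => hasUCP_of_forall_eq_zero hQ fun ε hε => (dense_shiftedLevyMeasures_iff ε).1 (h ε hε)⟩
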